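/- Let $m\ge 1$, let $H\in\mathbb Z^{m\times t}$ have full row rank, and suppose that $\operatorname{cone}(H)\subseteq\mathbb R^m$, the convex cone generated by the columns of $H$, is pointed (it contains no line). Suppose that $H$ has the Hilbert basis property: every integer vector in $\operatorname{cone}(H)$ is a nonnegative integer combination of the columns of $H$. Let $V\subseteq\mathbb Z^m$ be a finite set with $\operatorname{cone}(V)=\operatorname{cone}(H)$ (for example, a set of generators of the extreme rays of $\operatorname{cone}(H)$). For $b\in\mathbb Z^m$ let $P(H,b)=\{x\in\mathbb Z^t_{\ge0}: Hx=b\}$, let $\sigma(H,b)$ be the minimum number of nonzero entries of a vector in $P(H,b)$ (and $\infty$ if $P(H,b)=\emptyset$), and let $$\sigma^{\mathrm{asy}}(H)=\min\Big\{k\in\mathbb Z:\ \lim_{s\to\infty}\frac{|\{b\in\{-s,\dots,s\}^m:\sigma(H,b)\le k\}|}{|\{b\in\{-s,\dots,s\}^m:P(H,b)\ne\emptyset\}|}=1\Big\}.$$ Let $\delta^{\max}(V)$ be the maximum of $|\det W|$ over all invertible $m\times m$ matrices $W$ whose columns belong to $V$, and let $\phi^{\max}(V)$ be the maximum, over the same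 matrices $W$, of the number of prime factors of $|\det W|$, counted with multiplicity (so that $|\det W|=1$ counts $0$). Then these minima and maxima exist, and $$\sigma^{\mathrm{asy}}(H)\ \le\ m+\phi^{\max}(V)\ \le\ m+\log_2\delta^{\max}(V).$$ -/

import Mathlib

namespace SparseIP

/-- The convex cone in `ℝ^m` generated by a set of integer vectors. -/
def cone {m : ℕ} (S : Set (Fin m → ℤ)) : PointedCone ℝ (Fin m → ℝ) :=
  PointedCone.hull ℝ ((fun v : Fin m → ℤ => fun i => (v i : ℝ)) '' S)

/-- The columns of an integer matrix, as a set of vectors. -/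
def columns {m n : ℕ} (A : Matrix (Fin m) (Fin n) ℤ) : Set (Fin m → ℤ) :=
  Set.range fun j : Fin n => fun i : Fin m => A i j

/-- `A` has full row rank. -/
def FullRowRank {m n : ℕ} (A : Matrix (Fin m) (Fin n) ℤ) : Prop :=
  (A.map (Int.cast : ℤ → ℝ)).rank = m

/-- `P(A, b)`: the nonnegative integer solutions of `A x = b`. -/
def feasible {m n : ℕ} (A : Matrix (Fin m) (Fin n) ℤ) (b : Fin m → ℤ) : Set (Fin n → ℤ) :=
  {x | (∀ j, 0 ≤ x j) ∧ A.mulVec x = b}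

/-- The number of nonzero entries of `x`. -/
def suppCard {n : ℕ} (x : Fin n → ℤ) : ℕ :=
  (Finset.univ.filter fun j => x j ≠ 0).card

/-- `σ(A, b)`: the least support size of a point of `P(A, b)`, and `∞` if `P(A, b)` is empty. -/
noncomputable def support {m n : ℕ} (A : Matrix (Fin m) (Fin n) ℤ) (b : Fin m → ℤ) : ℕ∞ :=
  ⨅ x ∈ feasible A b, (suppCard x : ℕ∞)

/-- The box `{-t, ..., t}^m`. -/
def box (m t : ℕ) : Set (Fin m → ℤ) :=
  {b | ∀ i, -(t : ℤ) ≤ b i ∧ b i ≤ (t : ℤ)}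

/-- Among the feasible right-hand sides in the box `{-t, ..., t}^m`, the proportion of those
with `σ(A, b) ≤ k`. The denominator is positive, since `b = 0` is feasible. -/
noncomputable def sparseRatio {m n : ℕ} (A : Matrix (Fin m) (Fin n) ℤ) (k t : ℕ) : ℝ :=
  ({b | b ∈ box m t ∧ support A b ≤ (k : ℕ∞)}.ncard : ℝ) /
    ({b | b ∈ box m t ∧ (feasible A b).Nonempty}.ncard : ℝ)

/-- The `k` for which asymptotically almost all feasible right-hand sides have `σ(A, b) ≤ k`.
Negative integers `k` need not be considered: for them the proportion is constantly `0`. -/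
def asySet {m n : ℕ} (A : Matrix (Fin m) (Fin n) ℤ) : Set ℕ :=
  {k | Filter.Tendsto (fun t : ℕ => sparseRatio A k t) Filter.atTop (nhds 1)}

/-- The asymptotic support function `σ^asy(A)`. -/
noncomputable def asySupport {m n : ℕ} (A : Matrix (Fin m) (Fin n) ℤ) : ℕ :=
  sInf (asySet A)

/-- The columns of `A` form a Hilbert basis of the cone they generate: every integer vector in
that cone is a nonnegative integer combination of the columns. Minimality is not required. -/
def HilbertBasisProperty {m n : ℕ} (A : Matrix (Fin m) (Fin n) ℤ) : Prop :=
  ∀ b : Fin m → ℤ, (fun i => (b i : ℝ)) ∈ cone (columns A) → (feasible A b).Nonempty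

/-- `Δ(V)`: the absolute values of the nonzero `m × m` minors of the matrix whose columns are
the vectors in `V`. (Column `j` of the submatrix is `w j`; a repeated column gives a zero
determinant, and the order of the columns does not matter.) -/
def minors {m : ℕ} (V : Set (Fin m → ℤ)) : Set ℕ :=
  {d | ∃ w : Fin m → Fin m → ℤ, (∀ j, w j ∈ V) ∧
    (Matrix.of fun i j => w j i).det ≠ 0 ∧ d = (Matrix.of fun i j => w j i).det.natAbs}

/-- `Φ(V)`: the numbers of prime factors, counted with multiplicity, of the elements of `Δ(V)`;
the minor `1` has `0` prime factors. -/
def primeCounts {m : ℕ} (V : Set (Fin m → ℤ)) : Set ℕ :=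
  {r | ∃ d ∈ minors V, ∃ α : Fin r → ℕ, (∀ i, (α i).Prime) ∧ d = ∏ i, α i}

/-- `δ^max(V)`. -/
noncomputable def deltaMax {m : ℕ} (V : Set (Fin m → ℤ)) : ℕ := sSup (minors V)

/-- `φ^max(V)`. -/
noncomputable def phiMax {m : ℕ} (V : Set (Fin m → ℤ)) : ℕ := sSup (primeCounts V)

end SparseIP

/-!
Let `W` be an invertible matrix of `m` columns of `H` and `D = det W`. The columns of `H` generate
`ℤ^m` as a group (`closure_columns_eq_top`), and the columns of `W` generate a subgroup of index
`|D|`. Each column that enlarges the subgroup divides the index by an integer greater than `1`, so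
`Ω |D|` further columns are enough to generate all of `ℤ^m`
(`exists_finset_sup_closure_eq_top`). Thus `b` is an integer combination of these
`m + Ω |D|` columns. As `D • ℤ^m` is contained in the lattice of `W`, the coefficients of the
additional columns can be reduced modulo `D`; if the coordinates of `b` with respect to `W` are
large, the coefficients of the columns of `W` are then still nonnegative, and
`σ(H, b) ≤ m + Ω |D|` (`exists_support_le_of_deep`).

By Carathéodory's theorem (`exists_basis_conic`), the cone is the union of the simplicial cones of
such matrices `W`, and the matrices may be restricted to columns with a positive multiple in `V`:
the primitive vector on the ray of an irredundant element of `V` is a column of `H`, because the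
cone is pointed and `H` has the Hilbert basis property (`exists_column_of_irredundant`). The
determinants of these `W` divide minors of `V`, whence `Ω |D| ≤ φ^max(V)`.

A feasible `b` with `σ(H, b) > m + φ^max(V)` therefore has a small coordinate with respect to some
`W`. Up to the factor `D ^ 2` the coordinates are integers, so these `b` lie in finitely many
hyperplanes. They number `O(s^(m-1))` in the box of radius `s`, whereas the feasible vectors number
at least a constant times `s^m` (`mem_asySet_of_subset_hyperplanes`).

The last inequality is `2 ^ Ω d ≤ d`.
-/

namespace SparseIP

open scoped ArithmeticFunction.Omega

/-! ### Conic combinations -/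

lemma mem_hull_image_iff {ι E : Type*} [AddCommGroup E] [Module ℝ E] {v : ι → E} {J : Finset ι}
    {x : E} : x ∈ PointedCone.hull ℝ (v '' (J : Set ι)) ↔
      ∃ c : ι → ℝ, (∀ i, 0 ≤ c i) ∧ x = ∑ i ∈ J, c i • v i := by
  classical
  constructor
  · intro hx
    induction hx using Submodule.span_induction with
    | mem x hx =>
      obtain ⟨i, hi, rfl⟩ := hx
      exact ⟨Pi.single i 1, fun k => by rw [Pi.single_apply]; split_ifs <;> simp,
        by simp [Pi.single_apply, ite_smul, Finset.mem_coe.1 hi]⟩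
    | zero => exact ⟨0, fun _ => le_rfl, by simp⟩
    | add x y _ _ hx hy =>
      obtain ⟨c, hc, rfl⟩ := hx
      obtain ⟨d, hd, rfl⟩ := hy
      exact ⟨c + d, fun i => add_nonneg (hc i) (hd i), by
        simp [add_smul, Finset.sum_add_distrib]⟩
    | smul a x _ hx =>
      obtain ⟨c, hc, rfl⟩ := hx
      exact ⟨fun i => a.1 * c i, fun i => mul_nonneg a.2 (hc i), by
        rw [Finset.smul_sum]
        exact Finset.sum_congr rfl fun i _ => (mul_smul a.1 (c i) (v i)).symm⟩
  · rintro ⟨c, hc, rfl⟩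
    exact Submodule.sum_mem _ fun i hi => PointedCone.smul_mem _ (hc i)
      (PointedCone.subset_hull (Set.mem_image_of_mem v hi))

/-- Carathéodory's theorem for cones: a nonnegative combination of finitely many vectors can be
rewritten with linearly independent ones among them. -/
lemma exists_linearIndepOn_conic {ι E : Type*} [AddCommGroup E] [Module ℝ E] (v : ι → E)
    (S : Finset ι) (c : ι → ℝ) (hc : ∀ i ∈ S, 0 ≤ c i) :
    ∃ T ⊆ S, LinearIndepOn ℝ v (T : Set ι) ∧ ∃ d : ι → ℝ, (∀ i ∈ T, 0 ≤ d i) ∧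
      ∑ i ∈ S, c i • v i = ∑ i ∈ T, d i • v i := by
  classical
  induction S using Finset.strongInduction generalizing c with
  | H S ih =>
  by_cases hS : LinearIndepOn ℝ v (S : Set ι)
  · exact ⟨S, subset_rfl, hS, c, hc, rfl⟩
  obtain ⟨g, hg0, i₁, hi₁, hgi₁⟩ : ∃ g : ι → ℝ, ∑ i ∈ S, g i • v i = 0 ∧ ∃ i ∈ S, 0 < g i := by
    rw [linearIndepOn_finset_iff] at hS
    push Not at hS
    obtain ⟨g, hg0, i, hi, hgi⟩ := hS
    rcases lt_or_gt_of_ne hgi with h | h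
    · exact ⟨-g, by simp [hg0], i, hi, by simpa using h⟩
    · exact ⟨g, hg0, i, hi, h⟩
  -- The largest multiple of the relation that may be subtracted is set by the smallest ratio.
  obtain ⟨k, hk, hmin⟩ := Finset.exists_min_image (S.filter fun i => 0 < g i)
    (fun i => c i / g i) ⟨i₁, by simp [hi₁, hgi₁]⟩
  rw [Finset.mem_filter] at hk
  set r := c k / g k with hr
  have hr0 : 0 ≤ r := div_nonneg (hc k hk.1) hk.2.le
  obtain ⟨T, hTS, hT, d, hd, hsum⟩ := ih (S.erase k) (Finset.erase_ssubset hk.1)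
    (fun i => c i - r * g i) (fun i hi => by
      have hiS := Finset.mem_of_mem_erase hi
      rw [sub_nonneg]
      by_cases hgi : 0 < g i
      · exact (le_div_iff₀ hgi).1 (hmin i (Finset.mem_filter.2 ⟨hiS, hgi⟩))
      · exact (mul_nonpos_of_nonneg_of_nonpos hr0 (not_lt.1 hgi)).trans (hc i hiS))
  refine ⟨T, hTS.trans (Finset.erase_subset _ _), hT, d, hd, ?_⟩
  have hk0 : c k - r * g k = 0 := by rw [hr, div_mul_cancel₀ _ hk.2.ne', sub_self]
  rw [← hsum]
  have := Finset.add_sum_erase S (fun i => (c i - r * g i) • v i) hk.1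
  simp only [hk0, zero_smul, zero_add] at this
  rw [this]
  simp only [sub_smul, mul_smul, Finset.sum_sub_distrib, ← Finset.smul_sum, hg0, smul_zero,
    sub_zero]

/-- Conic Carathéodory, with the linearly independent vectors completed to a basis taken from
the given vectors. -/
lemma exists_basis_conic {m : ℕ} {ι : Type*} (v : ι → Fin m → ℝ) (J : Finset ι)
    (hspan : Submodule.span ℝ (v '' (J : Set ι)) = ⊤) {x : Fin m → ℝ}
    (hx : x ∈ PointedCone.hull ℝ (v '' (J : Set ι))) :
    ∃ f : Fin m → ι, (∀ k, f k ∈ J) ∧ LinearIndependent ℝ (v ∘ f) ∧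
      ∃ c : Fin m → ℝ, (∀ k, 0 ≤ c k) ∧ x = ∑ k, c k • v (f k) := by
  classical
  obtain ⟨c₀, hc₀, rfl⟩ := mem_hull_image_iff.1 hx
  obtain ⟨T, hTJ, hT, d, hd, hsum⟩ := exists_linearIndepOn_conic v J c₀ fun i _ => hc₀ i
  obtain ⟨B, hBJ, hTB, hJB, hB⟩ := exists_linearIndepOn_extension hT (Finset.coe_subset.2 hTJ)
  lift B to Finset ι using J.finite_toSet.subset hBJ
  rw [Finset.coe_subset] at hBJ hTB
  have htop : Submodule.span ℝ (v '' (B : Set ι)) = ⊤ :=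
    top_le_iff.1 (hspan ▸ Submodule.span_le.2 hJB)
  have hcard : B.card = m := by
    have h := finrank_span_eq_card (R := ℝ) (b := fun i : B => v i) hB
    rw [show Set.range (fun i : B => v i) = v '' (B : Set ι) from
      (Set.image_eq_range v B).symm, htop, finrank_top, Module.finrank_fin_fun,
      Fintype.card_coe] at h
    exact h.symm
  let e : Fin m ≃ B := (B.equivFinOfCardEq hcard).symm
  refine ⟨fun k => e k, fun k => hBJ (e k).2, hB.comp e e.injective,
    fun k => if (e k : ι) ∈ T then d (e k) else 0, fun k => ?_, ?_⟩
  · dsimp only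
    split_ifs with h
    exacts [hd _ h, le_rfl]
  · rw [hsum, Equiv.sum_comp e (fun i : B => (if (i : ι) ∈ T then d i else 0) • v i),
      Finset.sum_coe_sort B (fun i => (if i ∈ T then d i else 0) • v i)]
    simp only [ite_smul, zero_smul]
    rw [Finset.sum_ite_mem, Finset.inter_eq_right.2 hTB]

/-! ### Generating a group over a finite-index subgroup -/

/-- Every proper step up from a subgroup of finite index divides the index by an integer greater
than `1`, so at most `Ω` of the index many of the generators have to be added. -/
lemma exists_finset_sup_closure_eq_top {A ι : Type*} [AddCommGroup A] (h : ι → A)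
    (hgen : AddSubgroup.closure (Set.range h) = ⊤) (L : AddSubgroup A) (hL : L.index ≠ 0) :
    ∃ T : Finset ι, T.card ≤ Ω L.index ∧
      L ⊔ AddSubgroup.closure (h '' (T : Set ι)) = ⊤ := by
  classical
  induction hn : L.index using Nat.strong_induction_on generalizing L with
  | _ n ih =>
  by_cases hall : ∀ i, h i ∈ L
  · refine ⟨∅, by simp, ?_⟩
    have : L = ⊤ :=
      top_le_iff.1 (hgen ▸ (AddSubgroup.closure_le L).2 (Set.range_subset_iff.2 hall))
    simp [this]
  · push Not at hall
    obtain ⟨i, hi⟩ := hall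
    set L' := L ⊔ AddSubgroup.closure {h i} with hL'
    have hle : L ≤ L' := le_sup_left
    have hmul : L.relIndex L' * L'.index = L.index := AddSubgroup.relIndex_mul_index hle
    have hne : L'.index ≠ 0 := fun h0 => hL (by rw [← hmul, h0, mul_zero])
    have hne2 : L.relIndex L' ≠ 0 := fun h0 => hL (by rw [← hmul, h0, zero_mul])
    have hne1 : L.relIndex L' ≠ 1 := fun h1 => hi
      (AddSubgroup.relIndex_eq_one.1 h1
        ((le_sup_right : _ ≤ L') (AddSubgroup.subset_closure (Set.mem_singleton _))))
    have hlt : L'.index < n := by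
      rw [← hn, ← hmul]
      have : 2 ≤ L.relIndex L' := by omega
      nlinarith [Nat.pos_of_ne_zero hne]
    obtain ⟨T, hT, htop⟩ := ih _ hlt L' hne rfl
    refine ⟨insert i T, ?_, ?_⟩
    · rw [← hn, ← hmul, ArithmeticFunction.cardFactors_mul hne2 hne]
      have : 0 < Ω (L.relIndex L') := ArithmeticFunction.cardFactors_pos_iff_one_lt.2 (by omega)
      exact (Finset.card_insert_le _ _).trans (by omega)
    · rw [Finset.coe_insert, Set.image_insert_eq, Set.insert_eq, AddSubgroup.closure_union,
        ← sup_assoc, ← hL', htop]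

/-- The columns of an integer matrix with nonzero determinant span a lattice of index `|det|`. -/
lemma index_range_mulVecLin {m : ℕ} (W : Matrix (Fin m) (Fin m) ℤ) (hW : W.det ≠ 0) :
    (LinearMap.range W.mulVecLin).toAddSubgroup.index = W.det.natAbs := by
  have hinj : Function.Injective W.mulVecLin := Matrix.mulVec_injective_of_det_ne_zero hW
  have h := Submodule.natAbs_det_equiv (LinearMap.range W.mulVecLin)
    (LinearEquiv.ofInjective W.mulVecLin hinj)
  rw [← LinearMap.det_toLin' W, Matrix.toLin'_apply']
  exact h.symm

/-! ### Integer vectors as real vectors -/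

/-- The inclusion `ℤ^m → ℝ^m`. -/
def toReal (m : ℕ) : (Fin m → ℤ) →+ (Fin m → ℝ) := (Int.castAddHom ℝ).compLeft (Fin m)

@[simp] lemma toReal_apply {m : ℕ} (v : Fin m → ℤ) (i : Fin m) : toReal m v i = v i := rfl

lemma toReal_injective (m : ℕ) : Function.Injective (toReal m) := fun _ _ h =>
  funext fun i => Int.cast_injective (congrFun h i)

lemma toReal_smul {m : ℕ} (c : ℤ) (v : Fin m → ℤ) : toReal m (c • v) = (c : ℝ) • toReal m v := by
  ext i; simp

lemma mem_cone_iff {m : ℕ} {S : Finset (Fin m → ℤ)} {x : Fin m → ℝ} :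
    x ∈ cone (S : Set (Fin m → ℤ)) ↔
      ∃ c : (Fin m → ℤ) → ℝ, (∀ u, 0 ≤ c u) ∧ x = ∑ u ∈ S, c u • toReal m u :=
  mem_hull_image_iff (v := toReal m)

lemma toReal_mem_cone {m : ℕ} {S : Set (Fin m → ℤ)} {v : Fin m → ℤ} (hv : v ∈ S) :
    toReal m v ∈ cone S :=
  PointedCone.subset_hull (Set.mem_image_of_mem _ hv)

lemma cone_le_cone {m : ℕ} {S S' : Set (Fin m → ℤ)} (h : ∀ v ∈ S, toReal m v ∈ cone S') :
    cone S ≤ cone S' :=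
  Submodule.span_le.2 (Set.image_subset_iff.2 h)

lemma mulVec_eq_sum_smul {m n : ℕ} (A : Matrix (Fin m) (Fin n) ℤ) (x : Fin n → ℤ) :
    A.mulVec x = ∑ j, x j • A.transpose j := by
  ext i
  simp [Matrix.mulVec, dotProduct, mul_comm]

/-! ### Extreme rays of a cone with a Hilbert basis -/

/-- In a salient cone a vanishing nonnegative combination of nonzero vectors is trivial. -/
lemma eq_zero_of_sum_smul_eq_zero {E ι : Type*} [AddCommGroup E] [Module ℝ E]
    {C : PointedCone ℝ E} (hC : C.toConvexCone.Salient) {S : Finset ι} {v : ι → E}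
    (hv : ∀ i ∈ S, v i ∈ C) (hv0 : ∀ i ∈ S, v i ≠ 0) {c : ι → ℝ} (hc : ∀ i ∈ S, 0 ≤ c i)
    (h : ∑ i ∈ S, c i • v i = 0) : ∀ i ∈ S, c i = 0 := by
  classical
  intro i hi
  by_contra hne
  have hmem : ∀ k ∈ S, c k • v k ∈ C := fun k hk => C.smul_mem (hc k hk) (hv k hk)
  refine hC (c i • v i) (hmem i hi) (smul_ne_zero hne (hv0 i hi)) ?_
  rw [← Finset.add_sum_erase S _ hi] at h
  rw [neg_eq_of_add_eq_zero_right h]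
  exact Submodule.sum_mem C fun k hk => hmem k (Finset.mem_of_mem_erase hk)

/-- If `v` is an irredundant generator of the cone, then the primitive vector on the ray of `v`
is one of the columns: when it is written as a nonnegative integer combination of columns, all
columns that occur lie on the ray, and their multiplicities add up to `1`. -/
lemma exists_column_of_irredundant {m t : ℕ} {H : Matrix (Fin m) (Fin t) ℤ}
    (hpointed : (cone (columns H)).toConvexCone.Salient) (hH : HilbertBasisProperty H)
    {S : Finset (Fin m → ℤ)} (hS : cone (columns H) = cone (S : Set (Fin m → ℤ)))
    (hirr : ∀ v ∈ S, toReal m v ∉ cone ((S.erase v : Finset _) : Set (Fin m → ℤ)))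
    {v : Fin m → ℤ} (hv : v ∈ S) : ∃ j, ∃ d : ℤ, 0 < d ∧ d • H.transpose j = v := by
  classical
  have hne : ∀ u ∈ S, u ≠ 0 := by
    rintro u hu rfl
    exact hirr 0 hu (by rw [map_zero]; exact zero_mem _)
  have hne' : ∀ u ∈ S, toReal m u ≠ 0 := fun u hu h =>
    hne u hu (toReal_injective m (h.trans (map_zero _).symm))
  have hmemC : ∀ u ∈ S, toReal m u ∈ cone (columns H) := fun u hu => by
    rw [hS]; exact toReal_mem_cone (Finset.mem_coe.2 hu)
  -- `v = d • g` with `g` primitive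
  obtain ⟨i₀, hi₀⟩ := Function.ne_iff.1 (hne v hv)
  obtain ⟨g, hg, hg1⟩ := Finset.extract_gcd v (⟨i₀, Finset.mem_univ i₀⟩ : Finset.univ.Nonempty)
  set d : ℤ := Finset.univ.gcd v with hd
  have hd0 : 0 < d := by
    refine lt_of_le_of_ne ?_ fun h => hi₀ ?_
    · exact Int.nonneg_of_normalize_eq_self Finset.normalize_gcd
    · rw [hg i₀ (Finset.mem_univ _), ← h]; simp
  have hvg : v = d • g := funext fun i => by simpa using hg i (Finset.mem_univ _)
  have hdR : (0 : ℝ) < d := Int.cast_pos.2 hd0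
  obtain ⟨a, ha⟩ : ∃ a : Fin m → ℤ, ∑ i, a i * g i = 1 := by
    obtain ⟨p, hp⟩ := IsPrincipalIdealRing.principal (Ideal.span (Set.range g))
    have hp1 : p ∣ 1 := by
      rw [← hg1]
      refine Finset.dvd_gcd fun i _ => Ideal.mem_span_singleton.1 ?_
      have hi : g i ∈ Ideal.span (Set.range g) := Ideal.subset_span (Set.mem_range_self i)
      rwa [hp] at hi
    have h1 : (1 : ℤ) ∈ Ideal.span (Set.range g) := by
      rw [hp]; exact Ideal.mem_span_singleton.2 hp1
    exact Ideal.mem_span_range_iff_exists_fun.1 h1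
  have hgC : toReal m g ∈ cone (columns H) := by
    have := (cone (columns H)).smul_mem (inv_nonneg.2 hdR.le) (hmemC v hv)
    rwa [hvg, toReal_smul, smul_smul, inv_mul_cancel₀ hdR.ne', one_smul] at this
  obtain ⟨n, hn0, hn⟩ := hH g hgC
  rw [mulVec_eq_sum_smul] at hn
  have hcol : ∀ j, ∃ c : (Fin m → ℤ) → ℝ, (∀ u, 0 ≤ c u) ∧
      toReal m (H.transpose j) = ∑ u ∈ S, c u • toReal m u := fun j =>
    mem_cone_iff.1 (hS ▸ toReal_mem_cone (Set.mem_range_self j))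
  choose c hc0 hc using hcol
  -- the coefficients of `v` in terms of the generators, obtained through the columns
  set β : (Fin m → ℤ) → ℝ := fun u => d * ∑ j, n j * c j u with hβ
  have hβ0 : ∀ u, 0 ≤ β u := fun u => mul_nonneg hdR.le
    (Finset.sum_nonneg fun j _ => mul_nonneg (Int.cast_nonneg (hn0 j)) (hc0 j u))
  have hvβ : toReal m v = ∑ u ∈ S, β u • toReal m u := by
    rw [hvg, toReal_smul, ← hn, map_sum]
    simp only [toReal_smul, hc, hβ, Finset.smul_sum, smul_smul, Finset.mul_sum, Finset.sum_smul]
    exact Finset.sum_comm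
  rw [← Finset.add_sum_erase S _ hv] at hvβ
  set y := ∑ u ∈ S.erase v, β u • toReal m u with hy
  have hyS : y ∈ cone ((S.erase v : Finset _) : Set (Fin m → ℤ)) :=
    mem_cone_iff.2 ⟨β, hβ0, rfl⟩
  have hy' : y = (1 - β v) • toReal m v := by
    rw [sub_smul, one_smul, eq_sub_iff_add_eq, add_comm]; exact hvβ.symm
  have hβv : 1 ≤ β v := by
    by_contra! hlt
    refine hirr v hv ?_
    have h1 : 0 < 1 - β v := sub_pos.2 hlt
    have := PointedCone.smul_mem _ (inv_nonneg.2 h1.le) hyS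
    rwa [hy', smul_smul, inv_mul_cancel₀ h1.ne', one_smul] at this
  have hy0 : y = 0 := by
    by_contra hyne
    refine hpointed y ?_ hyne ?_
    · exact Submodule.sum_mem _ fun u hu =>
        PointedCone.smul_mem _ (hβ0 u) (hmemC u (Finset.mem_of_mem_erase hu))
    · rw [hy', ← neg_smul, neg_sub]
      exact PointedCone.smul_mem _ (sub_nonneg.2 hβv) (hmemC v hv)
  have hβu : ∀ u ∈ S.erase v, β u = 0 := eq_zero_of_sum_smul_eq_zero hpointed
    (fun u hu => hmemC u (Finset.mem_of_mem_erase hu))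
    (fun u hu => hne' u (Finset.mem_of_mem_erase hu)) (fun u _ => hβ0 u) hy0
  have hray : ∀ j, 0 < n j → toReal m (H.transpose j) = (c j v * d) • toReal m g := by
    intro j hj
    rw [hc j, ← Finset.add_sum_erase S _ hv, Finset.sum_eq_zero, add_zero, mul_smul,
      ← toReal_smul, ← hvg]
    intro u hu
    have h := (mul_eq_zero.1 (hβu u hu)).resolve_left hdR.ne'
    rw [Finset.sum_eq_zero_iff_of_nonneg fun k _ =>
      mul_nonneg (Int.cast_nonneg (hn0 k)) (hc0 k u)] at h
    rw [(mul_eq_zero.1 (h j (Finset.mem_univ j))).resolve_left (Int.cast_ne_zero.2 hj.ne'),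
      zero_smul]
  -- `k j` is the integer `k` with `H.transpose j = k • g`, for each column that occurs
  set k : Fin t → ℤ := fun j => ∑ i, a i * H i j with hk
  have hkR : ∀ j, 0 < n j → (k j : ℝ) = c j v * d := by
    intro j hj
    have h1 : ∀ i, (H i j : ℝ) = c j v * d * g i := fun i => congrFun (hray j hj) i
    have h2 : (∑ i, (a i : ℝ) * g i) = 1 := mod_cast ha
    simp only [hk, Int.cast_sum, Int.cast_mul, h1]
    calc ∑ i, (a i : ℝ) * (c j v * d * g i) = c j v * d * ∑ i, (a i : ℝ) * g i := by
          rw [Finset.mul_sum]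
          exact Finset.sum_congr rfl fun i _ => by ring
      _ = c j v * d := by rw [h2, mul_one]
  have hk0 : ∀ j, 0 ≤ n j * k j := by
    intro j
    rcases (hn0 j).eq_or_lt with h | h
    · simp [← h]
    · refine mul_nonneg h.le (Int.cast_nonneg_iff (R := ℝ).1 ?_)
      rw [hkR j h]
      exact mul_nonneg (hc0 j v) hdR.le
  have hsum : ∑ j, n j * k j = 1 := by
    rw [← ha, ← hn]
    simp only [hk, Finset.sum_apply, Pi.smul_apply, Matrix.transpose_apply, smul_eq_mul,
      Finset.mul_sum]
    rw [Finset.sum_comm]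
    exact Finset.sum_congr rfl fun i _ => Finset.sum_congr rfl fun j _ => by ring
  obtain ⟨j, -, hj⟩ := Finset.exists_ne_zero_of_sum_ne_zero (hsum.trans_ne one_ne_zero)
  have hj1 : n j * k j = 1 := le_antisymm
    (hsum ▸ Finset.single_le_sum (f := fun j => n j * k j) (fun i _ => hk0 i) (Finset.mem_univ j))
    (Int.add_one_le_iff.2 (lt_of_le_of_ne (hk0 j) hj.symm))
  have hnj : 0 < n j := lt_of_le_of_ne (hn0 j) fun h => hj (by rw [← h, zero_mul])
  have hkj : k j = 1 := by
    rwa [Int.eq_one_of_mul_eq_one_right hnj.le hj1, one_mul] at hj1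
  refine ⟨j, d, hd0, ?_⟩
  rw [hvg]
  congr 1
  refine toReal_injective m ?_
  rw [hray j hnj, ← hkR j hnj, hkj, Int.cast_one, one_smul]

/-- The cone of `H` is generated by columns of `H` that have a positive multiple in `V`. -/
lemma exists_columns_generating {m t : ℕ} {H : Matrix (Fin m) (Fin t) ℤ} {V : Set (Fin m → ℤ)}
    (hV : V.Finite) (hpointed : (cone (columns H)).toConvexCone.Salient)
    (hH : HilbertBasisProperty H) (hcone : cone (columns H) = cone V) :
    ∃ J : Finset (Fin t), (∀ j ∈ J, ∃ d : ℤ, 0 < d ∧ d • H.transpose j ∈ V) ∧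
      cone (columns H) = cone (H.transpose '' (J : Set (Fin t))) := by
  classical
  obtain ⟨S, hS, hmin⟩ := Finset.exists_min_image
    (hV.toFinset.powerset.filter fun S : Finset (Fin m → ℤ) =>
      cone (columns H) = cone (S : Set (Fin m → ℤ)))
    Finset.card ⟨hV.toFinset, by simp [hcone]⟩
  simp only [Finset.mem_filter, Finset.mem_powerset, and_imp] at hS hmin
  have hirr : ∀ v ∈ S, toReal m v ∉ cone ((S.erase v : Finset _) : Set (Fin m → ℤ)) := by
    intro v hv hmem
    refine (Finset.card_erase_lt_of_mem hv).not_ge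
      (hmin _ ((Finset.erase_subset _ _).trans hS.1) ?_)
    rw [hS.2]
    refine le_antisymm (cone_le_cone fun u hu => ?_) (cone_le_cone fun u hu =>
      toReal_mem_cone (Finset.mem_coe.2 (Finset.mem_of_mem_erase hu)))
    by_cases huv : u = v
    · rwa [huv]
    · exact toReal_mem_cone (Finset.mem_coe.2 (Finset.mem_erase.2 ⟨huv, hu⟩))
  have hcol := fun v (hv : v ∈ S) => exists_column_of_irredundant hpointed hH hS.2 hirr hv
  refine ⟨Finset.univ.filter fun j => ∃ d : ℤ, 0 < d ∧ d • H.transpose j ∈ S, fun j hj => ?_,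
    le_antisymm ?_ (cone_le_cone ?_)⟩
  · obtain ⟨d, hd, h⟩ := (Finset.mem_filter.1 hj).2
    exact ⟨d, hd, hV.mem_toFinset.1 (hS.1 h)⟩
  · rw [hS.2]
    refine cone_le_cone fun v hv => ?_
    obtain ⟨j, d, hd, rfl⟩ := hcol v hv
    rw [toReal_smul]
    refine PointedCone.smul_mem _ (Int.cast_nonneg hd.le) (toReal_mem_cone ⟨j, ?_, rfl⟩)
    simpa using ⟨d, hd, hv⟩
  · rintro _ ⟨j, -, rfl⟩
    exact toReal_mem_cone (Set.mem_range_self j)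

/-- The columns of `H` generate `ℤ^m` as a group: every integer vector becomes a member of the
cone when a large multiple of the sum of the columns is added. -/
lemma closure_columns_eq_top {m t : ℕ} {H : Matrix (Fin m) (Fin t) ℤ}
    (hspan : Submodule.span ℝ (Set.range fun j => toReal m (H.transpose j)) = ⊤)
    (hH : HilbertBasisProperty H) :
    AddSubgroup.closure (Set.range H.transpose) = ⊤ := by
  refine eq_top_iff.2 fun x _ => ?_
  have hmem : ∀ y : Fin t → ℤ, ∑ j, y j • H.transpose j ∈
      AddSubgroup.closure (Set.range H.transpose) := fun y =>
    AddSubgroup.sum_mem _ fun j _ => AddSubgroup.zsmul_mem _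
      (AddSubgroup.subset_closure (Set.mem_range_self j)) _
  obtain ⟨c, hc⟩ := (Submodule.mem_span_range_iff_exists_fun ℝ).1
    (hspan ▸ Submodule.mem_top : toReal m x ∈ _)
  obtain ⟨N, hN⟩ := exists_nat_ge (∑ j, |c j|)
  have hcN : ∀ j, 0 ≤ c j + N := fun j => by
    have := Finset.single_le_sum (f := fun j => |c j|) (fun i _ => abs_nonneg (c i))
      (Finset.mem_univ j)
    have h2 := neg_abs_le (c j)
    linarith
  have hxN : toReal m (x + ∑ j, (N : ℤ) • H.transpose j) ∈ cone (columns H) := by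
    rw [map_add, ← hc, map_sum, ← Finset.sum_add_distrib]
    refine Submodule.sum_mem _ fun j _ => ?_
    rw [toReal_smul, ← add_smul]
    exact PointedCone.smul_mem _ (by simpa using hcN j) (toReal_mem_cone (Set.mem_range_self j))
  obtain ⟨y, -, hy⟩ := hH _ hxN
  rw [mulVec_eq_sum_smul] at hy
  have := AddSubgroup.sub_mem _ (hmem y) (hmem fun _ => (N : ℤ))
  rwa [hy, add_sub_cancel_right] at this

lemma span_columns_eq_top {m t : ℕ} {H : Matrix (Fin m) (Fin t) ℤ} (hrank : FullRowRank H) :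
    Submodule.span ℝ (Set.range fun j => toReal m (H.transpose j)) = ⊤ := by
  refine Submodule.eq_top_of_finrank_eq ?_
  rw [Module.finrank_fin_fun]
  exact (Matrix.rank_eq_finrank_span_cols _).symm.trans hrank

/-! ### Sparse solutions deep inside a simplicial cone -/

lemma exists_sum_zsmul_of_mem_closure_image {A ι : Type*} [AddCommGroup A] {h : ι → A}
    {T : Finset ι} {x : A} (hx : x ∈ AddSubgroup.closure (h '' (T : Set ι))) :
    ∃ y : ι → ℤ, x = ∑ i ∈ T, y i • h i := by
  classical
  induction hx using AddSubgroup.closure_induction with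
  | mem x hx =>
    obtain ⟨i, hi, rfl⟩ := hx
    exact ⟨Pi.single i 1, by simp [Pi.single_apply, ite_smul, Finset.mem_coe.1 hi]⟩
  | zero => exact ⟨0, by simp⟩
  | add x y _ _ hx hy =>
    obtain ⟨c, rfl⟩ := hx
    obtain ⟨d, rfl⟩ := hy
    exact ⟨c + d, by simp [add_smul, Finset.sum_add_distrib]⟩
  | neg x _ hx =>
    obtain ⟨c, rfl⟩ := hx
    exact ⟨-c, by simp⟩

lemma support_le_of_mem_feasible {m n : ℕ} {A : Matrix (Fin m) (Fin n) ℤ} {b : Fin m → ℤ}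
    {x : Fin n → ℤ} (hx : x ∈ feasible A b) {k : ℕ} (hk : suppCard x ≤ k) :
    support A b ≤ k :=
  (iInf₂_le x hx).trans (Nat.cast_le.2 hk)

/-- Let `W` consist of columns of `H` and let `D = det W ≠ 0`. If the coordinates of `b` with
respect to the columns of `W` are large enough, then `b` has a solution that uses, besides the
columns of `W`, at most `Ω |D|` further columns. The coordinates are expressed by the integer
vector `D • adj W *ᵥ b`, which is `D ^ 2` times the vector of coordinates. -/
lemma exists_support_le_of_deep {m t : ℕ} {H : Matrix (Fin m) (Fin t) ℤ}
    (hgen : AddSubgroup.closure (Set.range H.transpose) = ⊤) (f : Fin m → Fin t)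
    (hdet : (H.submatrix id f).det ≠ 0) :
    ∃ K : ℤ, ∀ b : Fin m → ℤ,
      (∀ i, K ≤ (H.submatrix id f).det * ((H.submatrix id f).adjugate.mulVec b) i) →
      support H b ≤ ((m + Ω (H.submatrix id f).det.natAbs : ℕ) : ℕ∞) := by
  classical
  set W := H.submatrix id f with hW
  set D := W.det with hD
  obtain ⟨T, hTcard, hT⟩ := exists_finset_sup_closure_eq_top H.transpose hgen
    (LinearMap.range W.mulVecLin).toAddSubgroup
    (by rw [index_range_mulVecLin W hdet]; exact Int.natAbs_ne_zero.2 hdet)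
  rw [index_range_mulVecLin W hdet] at hTcard
  refine ⟨∑ i, ∑ j ∈ T, |D| * |D * (W.adjugate.mulVec (H.transpose j)) i|, fun b hb => ?_⟩
  obtain ⟨_, ⟨z, rfl⟩, y', hy', hb'⟩ :=
    AddSubgroup.mem_sup.1 (hT ▸ AddSubgroup.mem_top b : b ∈ _ ⊔ _)
  obtain ⟨y, rfl⟩ := exists_sum_zsmul_of_mem_closure_image hy'
  -- The coefficients outside `W` are reduced modulo `D`, since `D • ℤ^m` lies in the lattice.
  have hWadj : ∀ v, W.mulVec (W.adjugate.mulVec v) = D • v := fun v => by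
    rw [Matrix.mulVec_mulVec, Matrix.mul_adjugate, Matrix.smul_mulVec, Matrix.one_mulVec]
  have hadjW : ∀ v, W.adjugate.mulVec (W.mulVec v) = D • v := fun v => by
    rw [Matrix.mulVec_mulVec, Matrix.adjugate_mul, Matrix.smul_mulVec, Matrix.one_mulVec]
  set r : Fin t → ℤ := fun j => y j % D with hr
  have hr0 : ∀ j, 0 ≤ r j := fun j => Int.emod_nonneg _ hdet
  have hrD : ∀ j, r j ≤ |D| := fun j => (Int.emod_lt_abs _ hdet).le
  set x : Fin m → ℤ := z + ∑ j ∈ T, (y j / D) • W.adjugate.mulVec (H.transpose j) with hx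
  have hbx : b = W.mulVec x + ∑ j ∈ T, r j • H.transpose j := by
    rw [← hb', hx, Matrix.mulVec_add, Matrix.mulVec_sum, add_assoc, ← Finset.sum_add_distrib]
    simp only [Matrix.mulVecLin_apply, Matrix.mulVec_smul, hWadj, smul_smul, ← add_smul]
    congr 1
    refine Finset.sum_congr rfl fun j _ => ?_
    rw [mul_comm, Int.mul_ediv_add_emod]
  have hx0 : ∀ i, 0 ≤ x i := by
    intro i
    have h1 : D * W.adjugate.mulVec b i = D * D * x i +
        ∑ j ∈ T, r j * (D * W.adjugate.mulVec (H.transpose j) i) := by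
      rw [hbx, Matrix.mulVec_add, hadjW, Matrix.mulVec_sum]
      simp only [Matrix.mulVec_smul, Pi.add_apply, Pi.smul_apply, Finset.sum_apply, smul_eq_mul,
        mul_add, Finset.mul_sum, mul_assoc]
      congr 1
      exact Finset.sum_congr rfl fun j _ => by ring
    have h2 : ∑ j ∈ T, r j * (D * W.adjugate.mulVec (H.transpose j) i) ≤
        ∑ j ∈ T, |D| * |D * W.adjugate.mulVec (H.transpose j) i| :=
      Finset.sum_le_sum fun j _ => (mul_le_mul_of_nonneg_left (le_abs_self _) (hr0 j)).trans
        (mul_le_mul_of_nonneg_right (hrD j) (abs_nonneg _))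
    have h3 := Finset.single_le_sum
      (f := fun i => ∑ j ∈ T, |D| * |D * W.adjugate.mulVec (H.transpose j) i|)
      (fun i _ => Finset.sum_nonneg fun j _ => mul_nonneg (abs_nonneg _) (abs_nonneg _))
      (Finset.mem_univ i)
    have h4 : 0 ≤ D * D * x i := by linarith [hb i]
    exact nonneg_of_mul_nonneg_right h4 (mul_self_pos.2 hdet)
  -- the solution, as a combination of the columns of `W` and of those indexed by `T`
  set s : Fin t → ℤ := ∑ k, x k • Pi.single (f k) 1 + ∑ j ∈ T, r j • Pi.single j 1 with hs
  have hsingle : ∀ j : Fin t, H.mulVec (Pi.single j 1) = H.transpose j := fun j => by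
    rw [Matrix.mulVec_single_one]; rfl
  have hp : ∀ j k : Fin t, (0 : ℤ) ≤ (Pi.single j 1 : Fin t → ℤ) k := fun j k => by
    rw [Pi.single_apply]; split_ifs <;> simp
  refine support_le_of_mem_feasible (x := s) ⟨fun j => ?_, ?_⟩ ?_
  · simp only [hs, Pi.add_apply, Finset.sum_apply, Pi.smul_apply, smul_eq_mul]
    exact add_nonneg (Finset.sum_nonneg fun k _ => mul_nonneg (hx0 k) (hp _ _))
      (Finset.sum_nonneg fun k _ => mul_nonneg (hr0 k) (hp _ _))
  · rw [hs, Matrix.mulVec_add, Matrix.mulVec_sum, Matrix.mulVec_sum, hbx, mulVec_eq_sum_smul W]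
    simp only [Matrix.mulVec_smul, hsingle]
    rfl
  · have hsub : (Finset.univ.filter fun j => s j ≠ 0) ⊆ Finset.univ.image f ∪ T := by
      intro j hj
      by_contra hjn
      simp only [Finset.mem_union, Finset.mem_image, Finset.mem_univ, true_and, not_or,
        not_exists] at hjn
      refine (Finset.mem_filter.1 hj).2 ?_
      simp only [hs, Pi.add_apply, Finset.sum_apply, Pi.smul_apply, smul_eq_mul]
      rw [Finset.sum_eq_zero, Finset.sum_eq_zero, add_zero]
      · intro k hk
        rw [Pi.single_eq_of_ne, mul_zero]
        rintro rfl
        exact hjn.2 hk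
      · intro k _
        rw [Pi.single_eq_of_ne (fun h => hjn.1 k h.symm), mul_zero]
    refine (Finset.card_le_card hsub).trans ((Finset.card_union_le _ _).trans ?_)
    exact add_le_add (Finset.card_image_le.trans (by simp)) hTcard

/-! ### Counting lattice points -/

lemma box_eq_piFinset (m s : ℕ) :
    box m s = (Fintype.piFinset fun _ : Fin m => Finset.Icc (-(s : ℤ)) s : Finset _) := by
  ext b
  simp only [box, Finset.mem_coe, Fintype.mem_piFinset, Finset.mem_Icc]
  rfl

lemma finite_box (m s : ℕ) : (box m s).Finite := by
  rw [box_eq_piFinset]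
  exact Finset.finite_toSet _

/-- A hyperplane meets the box `{-s, ..., s}^m` in at most `(2 s + 1)^(m - 1)` integer points,
since one of the coordinates is determined by the others. -/
lemma ncard_hyperplane_inter_box_le {m : ℕ} {l : Fin m → ℤ} (hl : l ≠ 0) (c : ℤ) (s : ℕ) :
    {b | b ∈ box m s ∧ ∑ i, l i * b i = c}.ncard ≤ (2 * s + 1) ^ (m - 1) := by
  classical
  obtain ⟨i₀, hi₀⟩ := Function.ne_iff.1 hl
  set F : Finset ({i // i ≠ i₀} → ℤ) :=
    Fintype.piFinset fun _ => Finset.Icc (-(s : ℤ)) s with hF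
  have hcard : F.card = (2 * s + 1) ^ (m - 1) := by
    rw [hF, Fintype.card_piFinset, Finset.prod_const, Int.card_Icc, Finset.card_univ,
      Fintype.card_subtype_compl, Fintype.card_fin, Fintype.card_subtype_eq]
    congr 1
    omega
  rw [← hcard, ← Set.ncard_coe_finset]
  refine Set.ncard_le_ncard_of_injOn (fun b i => b i) (fun b hb => ?_) ?_ F.finite_toSet
  · exact Finset.mem_coe.2 (Fintype.mem_piFinset.2 fun i => Finset.mem_Icc.2 (hb.1 i))
  · intro b hb b' hb' h
    have hne : ∀ i, i ≠ i₀ → b i = b' i := fun i hi => congrFun h ⟨i, hi⟩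
    have heq : ∑ i, l i * b i = ∑ i, l i * b' i := hb.2.trans hb'.2.symm
    rw [← Finset.add_sum_erase _ _ (Finset.mem_univ i₀),
      ← Finset.add_sum_erase _ (fun i => l i * b' i) (Finset.mem_univ i₀),
      Finset.sum_congr rfl fun i hi => by rw [hne i (Finset.ne_of_mem_erase hi)],
      add_left_inj] at heq
    funext i
    by_cases hi : i = i₀
    · rw [hi]; exact mul_left_cancel₀ hi₀ heq
    · exact hne i hi

/-- There are at least `(s / M)^m` feasible right-hand sides in the box: the small nonnegative
combinations of linearly independent columns. -/
lemma exists_le_ncard_feasible {m t : ℕ} {H : Matrix (Fin m) (Fin t) ℤ} {f : Fin m → Fin t}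
    (hdet : (H.submatrix id f).det ≠ 0) :
    ∃ M : ℕ, 0 < M ∧ ∀ s : ℕ,
      ((s : ℝ) / M) ^ m ≤ {b | b ∈ box m s ∧ (feasible H b).Nonempty}.ncard := by
  classical
  set W := H.submatrix id f with hW
  set M : ℕ := 1 + ∑ i, ∑ k, (W i k).natAbs with hM
  have hM0 : 0 < M := by omega
  refine ⟨M, hM0, fun s => ?_⟩
  set q := s / M with hq
  set F : Finset (Fin m → ℕ) := Fintype.piFinset fun _ => Finset.range (q + 1) with hF
  have hcard : F.card = (q + 1) ^ m := by simp [hF]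
  have hle : (q + 1) ^ m ≤ {b | b ∈ box m s ∧ (feasible H b).Nonempty}.ncard := by
    rw [← hcard, ← Set.ncard_coe_finset]
    refine Set.ncard_le_ncard_of_injOn (fun x => W.mulVec fun k => (x k : ℤ)) (fun x hx => ?_) ?_
      ((finite_box m s).subset fun b hb => hb.1)
    · have hxq : ∀ k, x k ≤ q := fun k => by
        have := Fintype.mem_piFinset.1 (Finset.mem_coe.1 hx) k
        simp only [Finset.mem_range] at this
        omega
      refine ⟨fun i => abs_le.1 ?_, fun j => ∑ k, if f k = j then (x k : ℤ) else 0,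
        fun j => Finset.sum_nonneg fun k _ => by split_ifs <;> simp, ?_⟩
      · calc |∑ k, W i k * (x k : ℤ)| ≤ ∑ k, |W i k| * (q : ℤ) := by
              refine (Finset.abs_sum_le_sum_abs _ _).trans (Finset.sum_le_sum fun k _ => ?_)
              rw [abs_mul, Nat.abs_cast]
              exact mul_le_mul_of_nonneg_left (mod_cast hxq k) (abs_nonneg _)
          _ = ((∑ k, (W i k).natAbs : ℕ) : ℤ) * q := by
              rw [← Finset.sum_mul]; push_cast; rfl
          _ ≤ (M : ℤ) * q := by
              refine mul_le_mul_of_nonneg_right (Nat.cast_le.2 ?_) (Nat.cast_nonneg _)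
              have := Finset.single_le_sum (f := fun i => ∑ k, (W i k).natAbs)
                (fun _ _ => Nat.zero_le _) (Finset.mem_univ i)
              omega
          _ ≤ s := mod_cast Nat.mul_div_le s M
      · rw [mulVec_eq_sum_smul, mulVec_eq_sum_smul]
        simp only [Finset.sum_smul, ite_smul, zero_smul]
        rw [Finset.sum_comm]
        refine Finset.sum_congr rfl fun k _ => ?_
        rw [Finset.sum_ite_eq]
        simp only [Finset.mem_univ, if_true]
        rfl
    · intro x _ y _ h
      have h' := Matrix.mulVec_injective_of_det_ne_zero hdet h
      exact funext fun k => Int.natCast_inj.1 (congrFun h' k)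
  refine le_trans ?_ (Nat.cast_le.2 hle)
  rw [Nat.cast_pow]
  refine pow_le_pow_left₀ (by positivity) ?_ m
  rw [div_le_iff₀ (Nat.cast_pos.2 hM0)]
  have : s < (q + 1) * M := by rw [mul_comm]; exact Nat.lt_mul_div_succ s hM0
  exact_mod_cast this.le

/-- If the feasible right-hand sides with `σ > k` lie in finitely many hyperplanes, they form a
vanishing proportion of the feasible ones. -/
lemma mem_asySet_of_subset_hyperplanes {m t : ℕ} (hm : 1 ≤ m) {H : Matrix (Fin m) (Fin t) ℤ}
    {f : Fin m → Fin t} (hdet : (H.submatrix id f).det ≠ 0) {ι : Type*} (P : Finset ι)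
    (l : ι → Fin m → ℤ) (hl : ∀ p ∈ P, l p ≠ 0) (c : ι → ℤ) (k : ℕ)
    (hP : ∀ b, (feasible H b).Nonempty → ¬ support H b ≤ (k : ℕ∞) →
      ∃ p ∈ P, ∑ i, l p i * b i = c p) :
    k ∈ asySet H := by
  classical
  obtain ⟨M, hM0, hM⟩ := exists_le_ncard_feasible hdet
  set G : ℕ → Set (Fin m → ℤ) := fun s => {b | b ∈ box m s ∧ support H b ≤ (k : ℕ∞)} with hG
  set A : ℕ → Set (Fin m → ℤ) := fun s => {b | b ∈ box m s ∧ (feasible H b).Nonempty} with hA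
  have hAfin : ∀ s, (A s).Finite := fun s => (finite_box m s).subset fun b hb => hb.1
  have hGA : ∀ s, G s ⊆ A s := by
    refine fun s b hb => ⟨hb.1, ?_⟩
    by_contra hne
    rw [Set.not_nonempty_iff_eq_empty] at hne
    have h2 := hb.2
    simp [support, hne] at h2
  have hbad : ∀ s, (A s \ G s).ncard ≤ P.card * (2 * s + 1) ^ (m - 1) := by
    intro s
    have hsub : A s \ G s ⊆ ⋃ p ∈ P, {b | b ∈ box m s ∧ ∑ i, l p i * b i = c p} := by
      intro b hb
      obtain ⟨p, hp, h⟩ := hP b hb.1.2 fun h => hb.2 ⟨hb.1.1, h⟩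
      exact Set.mem_biUnion (Finset.mem_coe.2 hp) ⟨hb.1.1, h⟩
    refine (Set.ncard_le_ncard hsub ?_).trans ((Finset.set_ncard_biUnion_le _ _).trans ?_)
    · exact P.finite_toSet.biUnion fun p _ => (finite_box m s).subset fun b hb => hb.1
    · exact Finset.sum_le_card_nsmul _ _ _ fun p hp =>
        ncard_hyperplane_inter_box_le (hl p hp) (c p) s
  set C : ℝ := P.card * 3 ^ (m - 1) * (M : ℝ) ^ m with hC
  have hbound : ∀ s : ℕ, 1 ≤ s → 1 - C / s ≤ sparseRatio H k s := by
    intro s hs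
    have hs0 : (0 : ℝ) < s := by exact_mod_cast hs
    have hMR : (0 : ℝ) < M := Nat.cast_pos.2 hM0
    have hApos : (0 : ℝ) < (A s).ncard :=
      (by positivity : (0 : ℝ) < ((s : ℝ) / M) ^ m).trans_le (hM s)
    have hcard : ((A s \ G s).ncard : ℝ) + (G s).ncard = (A s).ncard := by
      exact_mod_cast Set.ncard_sdiff_add_ncard_of_subset (hGA s) (hAfin s)
    have hratio : sparseRatio H k s = 1 - ((A s \ G s).ncard : ℝ) / (A s).ncard := by
      rw [sparseRatio, eq_sub_iff_add_eq, ← add_div, add_comm, hcard, div_self hApos.ne']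
    rw [hratio]
    refine sub_le_sub_left ?_ 1
    rw [div_le_div_iff₀ hApos hs0]
    have h1 : ((A s \ G s).ncard : ℝ) ≤ P.card * (3 * s) ^ (m - 1) := by
      refine (Nat.cast_le.2 (hbad s)).trans ?_
      push_cast
      have : (2 * s + 1 : ℝ) ≤ 3 * s := by
        have : (1 : ℝ) ≤ s := by exact_mod_cast hs
        linarith
      gcongr
    calc ((A s \ G s).ncard : ℝ) * s ≤ P.card * (3 * s) ^ (m - 1) * s := by gcongr
      _ = P.card * 3 ^ (m - 1) * (s : ℝ) ^ m := by
          obtain ⟨n, rfl⟩ : ∃ n, m = n + 1 := ⟨m - 1, by omega⟩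
          rw [Nat.add_sub_cancel, mul_pow, pow_succ]
          ring
      _ = C * ((s : ℝ) / M) ^ m := by
          rw [hC, div_pow, mul_assoc _ ((M : ℝ) ^ m), mul_div_cancel₀ _ (pow_pos hMR m).ne']
      _ ≤ C * (A s).ncard := mul_le_mul_of_nonneg_left (hM s) (by positivity)
  refine tendsto_of_tendsto_of_tendsto_of_le_of_le' (g := fun s : ℕ => 1 - C / s)
    (h := fun _ => 1) ?_ tendsto_const_nhds ?_ (Filter.Eventually.of_forall fun s => ?_)
  · simpa using tendsto_const_nhds.sub (tendsto_const_div_atTop_nhds_zero_nat C)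
  · filter_upwards [Filter.eventually_ge_atTop 1] with s hs using hbound s hs
  · exact div_le_one_of_le₀ (Nat.cast_le.2 (Set.ncard_le_ncard (hGA s) (hAfin s)))
      (Nat.cast_nonneg _)

/-! ### Minors and their numbers of prime factors -/

lemma finite_minors {m : ℕ} {V : Set (Fin m → ℤ)} (hV : V.Finite) : (minors V).Finite := by
  refine ((Set.Finite.pi' fun _ : Fin m => hV).image
    fun w => (Matrix.of fun i j => w j i).det.natAbs).subset ?_
  rintro _ ⟨w, hw, -, rfl⟩
  exact ⟨w, hw, rfl⟩

lemma pos_of_mem_minors {m : ℕ} {V : Set (Fin m → ℤ)} {d : ℕ} (hd : d ∈ minors V) : 0 < d := by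
  obtain ⟨w, -, hw, rfl⟩ := hd
  exact Int.natAbs_pos.2 hw

lemma primeCounts_eq_image {m : ℕ} (V : Set (Fin m → ℤ)) :
    primeCounts V = (fun d => Ω d) '' minors V := by
  ext r
  constructor
  · rintro ⟨d, hd, α, hα, rfl⟩
    refine ⟨_, hd, ?_⟩
    have hperm := Nat.primeFactorsList_unique (l := List.ofFn α) (List.prod_ofFn)
      (by simpa [List.forall_mem_ofFn_iff] using hα)
    dsimp only
    rw [ArithmeticFunction.cardFactors_apply, ← hperm.length_eq, List.length_ofFn]
  · rintro ⟨d, hd, rfl⟩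
    refine ⟨d, hd, fun i => d.primeFactorsList.get i,
      fun i => Nat.prime_of_mem_primeFactorsList (List.get_mem _ i), ?_⟩
    exact (Nat.prod_primeFactorsList (pos_of_mem_minors hd).ne').symm.trans
      (Fin.prod_univ_getElem _).symm

lemma two_pow_le_of_mem_primeCounts {m : ℕ} {V : Set (Fin m → ℤ)} {r : ℕ}
    (hr : r ∈ primeCounts V) : ∃ d ∈ minors V, 2 ^ r ≤ d := by
  obtain ⟨d, hd, α, hα, rfl⟩ := hr
  refine ⟨_, hd, ?_⟩
  calc 2 ^ r = ∏ _i : Fin r, 2 := by simp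
    _ ≤ ∏ i, α i := Finset.prod_le_prod' fun i _ => (hα i).two_le

/-- If columns of `H` with positive multiples in `V` form a nonsingular matrix, then its
determinant divides a minor of `V`. -/
lemma cardFactors_det_le {m t : ℕ} {H : Matrix (Fin m) (Fin t) ℤ} {V : Set (Fin m → ℤ)}
    {f : Fin m → Fin t} (hdet : (H.submatrix id f).det ≠ 0)
    (hf : ∀ k, ∃ d : ℤ, 0 < d ∧ d • H.transpose (f k) ∈ V) :
    ∃ r ∈ primeCounts V, Ω (H.submatrix id f).det.natAbs ≤ r := by
  choose d hd hdV using hf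
  have hdet' : (Matrix.of fun i j => (d j • H.transpose (f j)) i).det =
      (∏ j, d j) * (H.submatrix id f).det :=
    Matrix.det_mul_row d (H.submatrix id f)
  have hprod : ∏ j, d j ≠ 0 := Finset.prod_ne_zero_iff.2 fun j _ => (hd j).ne'
  rw [primeCounts_eq_image]
  refine ⟨_, ⟨_, ⟨fun j => d j • H.transpose (f j), hdV, ?_, rfl⟩, rfl⟩, ?_⟩
  · rw [hdet']; exact mul_ne_zero hprod hdet
  · dsimp only
    rw [hdet', Int.natAbs_mul, ArithmeticFunction.cardFactors_mul (Int.natAbs_ne_zero.2 hprod)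
      (Int.natAbs_ne_zero.2 hdet)]
    exact Nat.le_add_left _ _

/-! ### Right-hand sides deep inside a simplicial cone -/

lemma det_submatrix_ne_zero_of_linearIndependent {m t : ℕ} {H : Matrix (Fin m) (Fin t) ℤ}
    {f : Fin m → Fin t} (hf : LinearIndependent ℝ ((fun j => toReal m (H.transpose j)) ∘ f)) :
    (H.submatrix id f).det ≠ 0 := by
  have h1 : IsUnit ((H.submatrix id f).map (Int.castRingHom ℝ)) :=
    Matrix.linearIndependent_cols_iff_isUnit.1 hf
  have h2 := ((Matrix.isUnit_iff_isUnit_det _).1 h1).ne_zero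
  intro h0
  rw [← RingHom.mapMatrix_apply, ← RingHom.map_det, h0, map_zero] at h2
  exact h2 rfl

/-- The coordinates of a vector in the simplicial cone of `W`, scaled by `(det W) ^ 2` so that they
are integers, are nonnegative. -/
lemma det_mul_adjugate_mulVec_nonneg {m t : ℕ} {H : Matrix (Fin m) (Fin t) ℤ}
    {f : Fin m → Fin t} (hf : LinearIndependent ℝ ((fun j => toReal m (H.transpose j)) ∘ f))
    {b : Fin m → ℤ} {c : Fin m → ℝ} (hc : ∀ k, 0 ≤ c k)
    (hb : toReal m b = ∑ k, c k • toReal m (H.transpose (f k))) (k : Fin m) :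
    0 ≤ (H.submatrix id f).det * ((H.submatrix id f).adjugate.mulVec b) k := by
  set W := H.submatrix id f with hW
  have h1 : ∑ k, W.adjugate.mulVec b k • H.transpose (f k) = W.det • b := by
    rw [← Matrix.one_mulVec (W.det • b), Matrix.mulVec_smul, ← Matrix.smul_mulVec,
      ← Matrix.mul_adjugate, ← Matrix.mulVec_mulVec, mulVec_eq_sum_smul W]
    rfl
  have h2 := congrArg (toReal m) h1
  rw [map_sum, toReal_smul, hb, Finset.smul_sum] at h2
  simp only [toReal_smul, smul_smul] at h2
  rw [← sub_eq_zero, ← Finset.sum_sub_distrib] at h2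
  simp only [← sub_smul] at h2
  have h3 := sub_eq_zero.1 (Fintype.linearIndependent_iff.1 hf _ h2 k)
  rw [← Int.cast_nonneg_iff (R := ℝ), Int.cast_mul, h3, ← mul_assoc]
  exact mul_nonneg (mul_self_nonneg _) (hc k)

/-- Outside finitely many hyperplanes, every feasible right-hand side lies deep inside a
simplicial cone spanned by columns that have positive multiples in `V`, where it has a solution
with at most `m + φ^max(V)` nonzero entries. -/
lemma add_phiMax_mem_asySet {m t : ℕ} (hm : 1 ≤ m) {H : Matrix (Fin m) (Fin t) ℤ}
    {V : Set (Fin m → ℤ)} (hV : V.Finite) (hH : HilbertBasisProperty H)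
    (hspan : Submodule.span ℝ (Set.range fun j => toReal m (H.transpose j)) = ⊤)
    {J : Finset (Fin t)} (hJV : ∀ j ∈ J, ∃ d : ℤ, 0 < d ∧ d • H.transpose j ∈ V)
    (hJ : cone (columns H) = cone (H.transpose '' (J : Set (Fin t)))) :
    (minors V).Nonempty ∧ m + phiMax V ∈ asySet H := by
  classical
  set v : Fin t → Fin m → ℝ := fun j => toReal m (H.transpose j) with hv
  have hull_J : cone (columns H) = PointedCone.hull ℝ (v '' (J : Set (Fin t))) :=
    hJ.trans (congrArg (PointedCone.hull ℝ) (Set.image_image (toReal m) H.transpose J))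
  have hspanJ : Submodule.span ℝ (v '' (J : Set (Fin t))) = ⊤ := by
    rw [← top_le_iff, ← hspan, Submodule.span_le]
    rintro _ ⟨j, rfl⟩
    exact PointedCone.hull_le_span ℝ _ (hull_J ▸ toReal_mem_cone (Set.mem_range_self j))
  have hΩ : ∀ f : Fin m → Fin t, (∀ k, f k ∈ J) → (H.submatrix id f).det ≠ 0 →
      ∃ r ∈ primeCounts V, Ω (H.submatrix id f).det.natAbs ≤ r := fun f hf hdet =>
    cardFactors_det_le hdet fun k => hJV _ (hf k)
  have hbdd : BddAbove (primeCounts V) := by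
    rw [primeCounts_eq_image]
    exact ((finite_minors hV).image _).bddAbove
  obtain ⟨f₀, hf₀J, hf₀, -⟩ := exists_basis_conic v J hspanJ (zero_mem _)
  have hdet₀ := det_submatrix_ne_zero_of_linearIndependent hf₀
  refine ⟨?_, ?_⟩
  · obtain ⟨r, hr, -⟩ := hΩ f₀ hf₀J hdet₀
    rw [primeCounts_eq_image] at hr
    exact hr.imp fun _ h => h.1
  have hgen := closure_columns_eq_top hspan hH
  have hdeep : ∀ f : Fin m → Fin t, ∃ K : ℤ, (H.submatrix id f).det ≠ 0 → ∀ b : Fin m → ℤ,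
      (∀ i, K ≤ (H.submatrix id f).det * ((H.submatrix id f).adjugate.mulVec b) i) →
      support H b ≤ ((m + Ω (H.submatrix id f).det.natAbs : ℕ) : ℕ∞) := fun f => by
    by_cases hdet : (H.submatrix id f).det = 0
    · exact ⟨0, fun h => absurd hdet h⟩
    · obtain ⟨K, hK⟩ := exists_support_le_of_deep hgen f hdet
      exact ⟨K, fun _ => hK⟩
  choose K hK using hdeep
  -- one hyperplane for each basis, each coordinate and each small value of that coordinate
  let P : Finset (Σ _ : (Fin m → Fin t) × Fin m, ℤ) :=
    (Finset.univ.filter fun p : (Fin m → Fin t) × Fin m => (H.submatrix id p.1).det ≠ 0).sigma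
      fun p => Finset.Ico 0 (K p.1)
  refine mem_asySet_of_subset_hyperplanes hm hdet₀ P
    (fun p => (H.submatrix id p.1.1).det • (H.submatrix id p.1.1).adjugate p.1.2)
    (fun p hp h0 => ?_) (fun p => p.2) _ fun b hb hbad => ?_
  · have hdet := (Finset.mem_filter.1 (Finset.mem_sigma.1 hp).1).2
    refine hdet ?_
    have h1 := (smul_eq_zero.1 h0).resolve_left hdet
    have h2 := congrFun (congrFun (Matrix.adjugate_mul (H.submatrix id p.1.1)) p.1.2) p.1.2
    rw [Matrix.mul_apply] at h2
    simpa [h1] using h2.symm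
  · have hbC : toReal m b ∈ cone (columns H) := by
      obtain ⟨x, hx0, rfl⟩ := hb
      rw [mulVec_eq_sum_smul, map_sum]
      refine Submodule.sum_mem _ fun j _ => ?_
      rw [toReal_smul]
      exact PointedCone.smul_mem _ (Int.cast_nonneg (hx0 j))
        (toReal_mem_cone (Set.mem_range_self j))
    rw [hull_J] at hbC
    obtain ⟨f, hfJ, hf, c, hc, hbc⟩ := exists_basis_conic v J hspanJ hbC
    have hdet := det_submatrix_ne_zero_of_linearIndependent hf
    have hlow : ∃ i, (H.submatrix id f).det * ((H.submatrix id f).adjugate.mulVec b) i < K f := by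
      by_contra! hall
      obtain ⟨r, hr, hle⟩ := hΩ f hfJ hdet
      exact hbad ((hK f hdet b hall).trans
        (Nat.cast_le.2 (Nat.add_le_add_left (hle.trans (le_csSup hbdd hr)) m)))
    obtain ⟨i, hi⟩ := hlow
    refine ⟨⟨(f, i), (H.submatrix id f).det * ((H.submatrix id f).adjugate.mulVec b) i⟩,
      Finset.mem_sigma.2 ⟨by simpa using hdet, Finset.mem_Ico.2
        ⟨det_mul_adjugate_mulVec_nonneg hf hc hbc i, hi⟩⟩, ?_⟩
    simp only [Pi.smul_apply, smul_eq_mul, mul_assoc, ← Finset.mul_sum]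
    rfl

end SparseIP

theorem corollary1 (m t : ℕ) (hm : 1 ≤ m)
    (H : Matrix (Fin m) (Fin t) ℤ) (V : Set (Fin m → ℤ)) (hV : V.Finite)
    (hrank : SparseIP.FullRowRank H)
    (hpointed : (SparseIP.cone (SparseIP.columns H)).toConvexCone.Salient)
    (hH : SparseIP.HilbertBasisProperty H)
    (hcone : SparseIP.cone (SparseIP.columns H) = SparseIP.cone V) :
    -- the minimum and the two maxima in the definitions are attained
    IsLeast (SparseIP.asySet H) (SparseIP.asySupport H) ∧
    IsGreatest (SparseIP.primeCounts V) (SparseIP.phiMax V) ∧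
    IsGreatest (SparseIP.minors V) (SparseIP.deltaMax V) ∧
    -- the two inequalities
    SparseIP.asySupport H ≤ m + SparseIP.phiMax V ∧
    (m : ℝ) + (SparseIP.phiMax V : ℝ) ≤ (m : ℝ) + Real.logb 2 (SparseIP.deltaMax V : ℝ) := by
  obtain ⟨J, hJV, hJ⟩ := SparseIP.exists_columns_generating hV hpointed hH hcone
  obtain ⟨hne, hmem⟩ := SparseIP.add_phiMax_mem_asySet hm hV hH
    (SparseIP.span_columns_eq_top hrank) hJV hJ
  have hfin := SparseIP.finite_minors hV
  have hδ : IsGreatest (SparseIP.minors V) (SparseIP.deltaMax V) :=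
    ⟨Nat.sSup_mem hne hfin.bddAbove, fun _ h => le_csSup hfin.bddAbove h⟩
  have hφ : IsGreatest (SparseIP.primeCounts V) (SparseIP.phiMax V) := by
    have hbdd : BddAbove (SparseIP.primeCounts V) := by
      rw [SparseIP.primeCounts_eq_image]
      exact (hfin.image _).bddAbove
    refine ⟨Nat.sSup_mem ?_ hbdd, fun _ h => le_csSup hbdd h⟩
    rw [SparseIP.primeCounts_eq_image]
    exact hne.image _
  refine ⟨⟨Nat.sInf_mem ⟨_, hmem⟩, fun _ h => Nat.sInf_le h⟩, hφ, hδ, Nat.sInf_le hmem, ?_⟩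
  obtain ⟨d, hd, hle⟩ := SparseIP.two_pow_le_of_mem_primeCounts hφ.1
  have hpow : (2 : ℝ) ^ SparseIP.phiMax V ≤ SparseIP.deltaMax V :=
    mod_cast hle.trans (hδ.2 hd)
  rw [add_le_add_iff_left, Real.le_logb_iff_rpow_le one_lt_two
    (Nat.cast_pos.2 (SparseIP.pos_of_mem_minors hδ.1)), Real.rpow_natCast]
  exact hpow
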